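/- Let $p\in(1,\infty)$, $c\in(0,2]$, $\lambda>0$, and let $(G,d)$ be a complete $p$-uniformly convex metric space with constant $c$; that is, any two points of $G$ are joined by a geodesic, and $$d(z,(1-t)x\oplus ty)^p\le(1-t)\,d(z,x)^p+t\,d(z,y)^p-\tfrac c2\,t(1-t)\,d(x,y)^p\qquad(x,y,z\in G,\ t\in[0,1]),$$ where $(1-t)x\oplus ty$ is the point at parameter $t$ on a constant-speed geodesic from $x$ to $y$. Let $f\colon G\to\mathbb R\cup\{+\infty\}$ be proper, convex (along geodesics) and lower semicontinuous. Then for every $x\in G$ the function $y\mapsto f(y)+\frac{1}{p\lambda^{p-1}}d(y,x)^p$ has a unique minimizer over $G$, denoted $T(x)=\operatorname{prox}^p_{f,\lambda}(x)$. For $a>0$ write $$\psi_T^{(p,a)}(x,y)=\tfrac a2\bigl(d(Tx,x)^p+d(Ty,y)^p+d(Tx,Ty)^p+d(x,y)^p-d(Tx,y)^p-d(x,Ty)^p\bigr).$$ (i) Suppose that $G$ is symmetric perpendicular, i.e. for all geodesic segments $\gamma,\eta$ with a common point $q$ one has $\gamma\perp_q\eta\iff\eta\perp_q\gamma$, where $\gamma\perp_q\eta$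 means $d(x,q)\le d(x,y)$ for all $x\in\gamma$, $y\in\eta$. Then $\operatorname{argmin} f=\operatorname{Fix}T$, and $T$ is quasi strictly nonexpansive: $d(Tx,\bar x)<d(x,\bar x)$ for all $\bar x\in\operatorname{Fix}T$ and all $x\in G\setminus\operatorname{Fix}T$. (ii) If $c>1$, then $T$ is pointwise almost $\alpha$-firmly nonexpansive at every $y\in\operatorname{argmin}f$ on $G$ with constant $\alpha_c=\frac{c(c-1)}{c(c-1)+2}$ and violation (at most) $\epsilon_c=\frac{2-c}{c-1}$; that is, $\alpha_c\in(0,1)$, $\epsilon_c\ge 0$, and for all $x\in G$ $$d(Tx,Ty)^p\le(1+\epsilon_c)\,d(x,y)^p-\tfrac{1-\alpha_c}{\alpha_c}\,\psi_T^{(p,c)}(x,y).$$ (iii) If $G$ is a CAT$(\kappa)$ space for some $\kappa\in\mathbb R$, then $T$ is pointwise asymptotically $\alpha$-firmly nonexpansive at every $y\in\operatorname{argmin}f$ with constant $\bar\alpha=\frac12$; that is, for every $c'\in(0,2]$ (in particular for $c'=c$) and every $\epsilon>0$ there is a neighborhood $U$ of $y$ such that for all $x\in U$ $$d(Tx,Ty)^p\le(1+\epsilon)\,d(x,y)^p-\tfrac{1-\bar\alpha}{\bar\alpha}\,\psi_T^{(p,c')}(x,y).$$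 -/

import Mathlib

open Set Filter Topology

noncomputable section

namespace PProx

/-- `γ`, restricted to `[0,1]`, is a constant-speed minimal geodesic from `x` to `y`;
the point `γ t` is then a point `(1-t)x ⊕ ty`. -/
def IsGeodesic {G : Type*} [MetricSpace G] (γ : ℝ → G) (x y : G) : Prop :=
  γ 0 = x ∧ γ 1 = y ∧
    ∀ s ∈ Icc (0 : ℝ) 1, ∀ t ∈ Icc (0 : ℝ) 1, dist (γ s) (γ t) = |s - t| * dist x y

/-- `G` is a geodesic space and
`d(z, (1-t)x ⊕ ty)^p ≤ (1-t) d(z,x)^p + t d(z,y)^p - (c/2) t (1-t) d(x,y)^p`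
along every geodesic. -/
def PUniformlyConvex (G : Type*) [MetricSpace G] (p c : ℝ) : Prop :=
  (∀ x y : G, ∃ γ : ℝ → G, IsGeodesic γ x y) ∧
    ∀ (x y z : G) (γ : ℝ → G), IsGeodesic γ x y → ∀ t ∈ Icc (0 : ℝ) 1,
      dist z (γ t) ^ p ≤
        (1 - t) * dist z x ^ p + t * dist z y ^ p - c / 2 * t * (1 - t) * dist x y ^ p

/-- `S` is the image of a geodesic segment. -/
def IsGeodesicSegment {G : Type*} [MetricSpace G] (S : Set G) : Prop :=
  ∃ (x y : G) (γ : ℝ → G), IsGeodesic γ x y ∧ S = γ '' Icc (0 : ℝ) 1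

/-- `S ⊥_q S'`. -/
def PerpAt {G : Type*} [MetricSpace G] (S S' : Set G) (q : G) : Prop :=
  ∀ x ∈ S, ∀ y ∈ S', dist x q ≤ dist x y

def SymmetricPerpendicular (G : Type*) [MetricSpace G] : Prop :=
  ∀ S S' : Set G, IsGeodesicSegment S → IsGeodesicSegment S' →
    ∀ q ∈ S ∩ S', PerpAt S S' q ↔ PerpAt S' S q

/-- Proper: never `-∞`, not identically `+∞`. -/
def ProperFun {G : Type*} (f : G → EReal) : Prop :=
  (∀ x, f x ≠ ⊥) ∧ ∃ x, f x ≠ ⊤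

/-- Convexity along all geodesics. -/
def GeodesicallyConvex {G : Type*} [MetricSpace G] (f : G → EReal) : Prop :=
  ∀ (x y : G) (γ : ℝ → G), IsGeodesic γ x y → ∀ t ∈ Icc (0 : ℝ) 1,
    f (γ t) ≤ ((1 - t : ℝ) : EReal) * f x + (t : EReal) * f y

/-- The set of global minimizers. -/
def argmin {G : Type*} (g : G → EReal) : Set G :=
  {y | ∀ z, g y ≤ g z}

/-- The argmin set that defines the `p`-proximal mapping of `f` with parameter `lam` at `x`. -/
def proxSet {G : Type*} [MetricSpace G] (p lam : ℝ) (f : G → EReal) (x : G) : Set G :=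
  argmin fun y => f y + ((1 / (p * lam ^ (p - 1)) * dist y x ^ p : ℝ) : EReal)

/-- `T` is the `p`-proximal mapping of `f`: at every `x` the argmin set is the singleton `{T x}`. -/
def IsProx {G : Type*} [MetricSpace G] (p lam : ℝ) (f : G → EReal) (T : G → G) : Prop :=
  ∀ x, proxSet p lam f x = {T x}

/-- The transport discrepancy `ψ_T^{(p,c)}(x,y)`. -/
def transportDiscrepancy {G : Type*} [MetricSpace G] (p c : ℝ) (T : G → G) (x y : G) : ℝ :=
  c / 2 * (dist (T x) x ^ p + dist (T y) y ^ p + dist (T x) (T y) ^ p + dist x y ^ p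
    - dist (T x) y ^ p - dist x (T y) ^ p)

/-- Strict decrease of the distance to every fixed point, at every point that is not itself fixed
(at a fixed point the strict inequality is never possible). -/
def QuasiStrictlyNonexpansive {G : Type*} [MetricSpace G] (T : G → G) : Prop :=
  ∀ x ∉ Function.fixedPoints T, ∀ y ∈ Function.fixedPoints T, dist (T x) y < dist x y

/-- `T` is pointwise almost `α`-firmly nonexpansive at `y ∈ D` on `D`, with constant `α` and
violation (at most) `ε`. -/
def AlmostFirmlyNonexpansiveAt {G : Type*} [MetricSpace G] (p c α ε : ℝ) (T : G → G)
    (D : Set G) (y : G) : Prop :=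
  α ∈ Ioo (0 : ℝ) 1 ∧ 0 ≤ ε ∧ y ∈ D ∧ ∀ x ∈ D,
    dist (T x) (T y) ^ p ≤
      (1 + ε) * dist x y ^ p - (1 - α) / α * transportDiscrepancy p c T x y

/-- `T` is pointwise asymptotically `α`-firmly nonexpansive at `y` with constant `α`. -/
def AsymptoticallyFirmlyNonexpansiveAt {G : Type*} [MetricSpace G] (p c α : ℝ) (T : G → G)
    (y : G) : Prop :=
  α ∈ Ioo (0 : ℝ) 1 ∧ ∀ ε > 0, ∃ U ∈ 𝓝 y, ∀ x ∈ U,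
    dist (T x) (T y) ^ p ≤
      (1 + ε) * dist x y ^ p - (1 - α) / α * transportDiscrepancy p c T x y

/-- Triangle comparison of `G` with a model plane `M` with distance function `δ`: every geodesic
triangle with vertices `x, y, z` (of perimeter less than `2π/√κ` if `κ > 0`) has a comparison
triangle `x', y', z'` in `M` such that any two points on two sides of the triangle are at most as
far apart as their comparison points. By relabelling, the two sides may be taken to be those that
meet at `x`. -/
def TriangleComparison (G : Type*) [MetricSpace G] (κ : ℝ) {M : Type} (δ : M → M → ℝ) : Prop :=
  ∀ x y z : G, (0 < κ → √κ * (dist x y + dist y z + dist z x) < 2 * Real.pi) →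
    ∃ x' y' z' : M, δ x' y' = dist x y ∧ δ y' z' = dist y z ∧ δ z' x' = dist z x ∧
      ∀ γ η : ℝ → G, IsGeodesic γ x y → IsGeodesic η x z →
        ∀ s ∈ Icc (0 : ℝ) 1, ∀ t ∈ Icc (0 : ℝ) 1, ∀ u v : M,
          δ x' u = s * dist x y → δ u y' = (1 - s) * dist x y →
          δ x' v = t * dist x z → δ v z' = (1 - t) * dist x z →
          dist (γ s) (η t) ≤ δ u v

/-- The distance of the unit sphere of `ℝ³` with its angular metric, scaled to curvature `κ > 0`. -/
def sphereDist (κ : ℝ) (u v : Metric.sphere (0 : EuclideanSpace ℝ (Fin 3)) 1) : ℝ :=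
  InnerProductGeometry.angle (u : EuclideanSpace ℝ (Fin 3)) v / √κ

/-- The distance of the hyperbolic plane, scaled to curvature `κ < 0`. -/
def hyperbolicDist (κ : ℝ) (u v : UpperHalfPlane) : ℝ :=
  dist u v / √(-κ)

/-- `G` is a CAT(`κ`) space: points at distance less than `π/√κ` (any two points if `κ ≤ 0`) are
joined by a geodesic, and triangle comparison holds with the model plane of curvature `κ`. -/
def IsCAT (G : Type*) [MetricSpace G] (κ : ℝ) : Prop :=
  (∀ x y : G, (0 < κ → √κ * dist x y < Real.pi) → ∃ γ : ℝ → G, IsGeodesic γ x y) ∧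
    (0 < κ → TriangleComparison G κ (sphereDist κ)) ∧
    (κ = 0 → TriangleComparison G κ
      (fun u v : EuclideanSpace ℝ (Fin 2) => dist u v)) ∧
    (κ < 0 → TriangleComparison G κ (hyperbolicDist κ))

end PProx

end

namespace PProx

variable {G : Type*} [MetricSpace G] {p c : ℝ} {f : G → EReal}

/-! Uniform convexity at midpoints makes every minimizing sequence of the regularized function
Cauchy, and lower semicontinuity makes its limit a minimizer; this yields `T`.

Everything else rests on one observation (`IsProx.dist_le_of_isGeodesic`). If `y` minimizes `f`,
then by convexity `f` does not exceed `f (T x)` on a geodesic from `T x` to `y`, so minimality of `T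
x` forces `T x` to be a point of that geodesic nearest to `x`. Three readings of this follow.

For (i), the segment from `T x` to `x` is perpendicular to the one from `T x` to `y`. Symmetry swaps
the roles, so `T x` is no farther from `y` than the midpoint of `T x` and `x`, and uniform convexity
there gives strict decrease.

For (ii), differentiating the uniform convexity inequality at the nearest point gives `c/2 *
d(Tx,y)^p + d(x,Tx)^p ≤ d(x,y)^p`; the stated constants follow from `c - 1 ≤ c/2`.

For (iii), nearness passes to the comparison triangle, where the first variation gives the
spherical, Euclidean or hyperbolic Pythagorean inequality. Up to a fourth-order error this is
`d(Tx,y)^2 + d(x,Tx)^2 ≤ d(x,y)^2`, and raising it to the power `p/2 ≥ 1` gives the claim. If `p <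
2`, the space is a single point. -/

theorem IsGeodesic.dist_left {γ : ℝ → G} {x y : G} (h : IsGeodesic γ x y) {t : ℝ}
    (ht : t ∈ Icc (0 : ℝ) 1) : dist x (γ t) = t * dist x y := by
  have := h.2.2 0 ⟨le_rfl, zero_le_one⟩ t ht
  rwa [h.1, zero_sub, abs_neg, abs_of_nonneg ht.1] at this

theorem IsGeodesic.dist_right {γ : ℝ → G} {x y : G} (h : IsGeodesic γ x y) {t : ℝ}
    (ht : t ∈ Icc (0 : ℝ) 1) : dist (γ t) y = (1 - t) * dist x y := by
  have := h.2.2 t ht 1 ⟨zero_le_one, le_rfl⟩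
  rwa [h.2.1, abs_sub_comm, abs_of_nonneg (sub_nonneg.2 ht.2)] at this

/-! ### Existence and uniqueness of the proximal point -/

theorem GeodesicallyConvex.real_le (hconv : GeodesicallyConvex f) (hbot : ∀ x, f x ≠ ⊥)
    {x y : G} {γ : ℝ → G} (h : IsGeodesic γ x y) {t : ℝ} (ht : t ∈ Icc (0 : ℝ) 1)
    (hx : f x ≠ ⊤) (hy : f y ≠ ⊤) :
    f (γ t) ≠ ⊤ ∧ (f (γ t)).toReal ≤ (1 - t) * (f x).toReal + t * (f y).toReal := by
  have h1 := hconv x y γ h t ht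
  rw [← EReal.coe_toReal hx (hbot x), ← EReal.coe_toReal hy (hbot y), ← EReal.coe_mul,
    ← EReal.coe_mul, ← EReal.coe_add] at h1
  have h2 : f (γ t) ≠ ⊤ := ne_top_of_le_ne_top (EReal.coe_ne_top _) h1
  refine ⟨h2, ?_⟩
  rw [← EReal.coe_toReal h2 (hbot _)] at h1
  exact_mod_cast h1

/-- A proper lower semicontinuous convex function is bounded below by an affine function of the
distance to a point of its domain. -/
theorem exists_affine_minorant (hgeo : ∀ x y : G, ∃ γ : ℝ → G, IsGeodesic γ x y)
    (hbot : ∀ x, f x ≠ ⊥) (hconv : GeodesicallyConvex f) (hlsc : LowerSemicontinuous f)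
    {x₀ : G} (hx₀ : f x₀ ≠ ⊤) :
    ∃ a b : ℝ, 0 ≤ b ∧ ∀ y, f y ≠ ⊤ → a - b * dist x₀ y ≤ (f y).toReal := by
  set r := (f x₀).toReal with hr
  have hlt : ((r - 1 : ℝ) : EReal) < f x₀ := by
    rw [← EReal.coe_toReal hx₀ (hbot x₀)]
    exact_mod_cast sub_one_lt r
  obtain ⟨ρ, hρ, hball⟩ := Metric.eventually_nhds_iff.1 (hlsc x₀ _ hlt)
  have hreal : ∀ y, f y ≠ ⊤ → dist y x₀ < ρ → r - 1 < (f y).toReal := by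
    intro y hy hd
    have : ((r - 1 : ℝ) : EReal) < f y := hball hd
    rw [← EReal.coe_toReal hy (hbot y)] at this
    exact_mod_cast this
  refine ⟨r - 1, 2 / ρ, by positivity, fun y hy => ?_⟩
  rcases lt_or_ge (dist y x₀) ρ with hd | hd
  · have := hreal y hy hd
    have : 0 ≤ 2 / ρ * dist x₀ y := by positivity
    linarith
  · obtain ⟨γ, hγ⟩ := hgeo x₀ y
    rw [dist_comm] at hd
    have hD : 0 < dist x₀ y := hρ.trans_le hd
    -- The point at parameter `t` lies at distance `ρ/2` from `x₀`, where `f` exceeds `r - 1`;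
    -- convexity then bounds the slope from `x₀` to `y` below by `-2/ρ`.
    set t := ρ / (2 * dist x₀ y) with htdef
    have ht0 : 0 < t := by positivity
    have ht : t ∈ Icc (0 : ℝ) 1 := ⟨ht0.le, by rw [htdef, div_le_one (by positivity)]; linarith⟩
    obtain ⟨h1, h2⟩ := hconv.real_le hbot hγ ht hx₀ hy
    have htD : t * dist x₀ y = ρ / 2 := by rw [htdef]; field_simp
    have h3 := hreal _ h1 (by rw [dist_comm, hγ.dist_left ht, htD]; linarith)
    have h4 : 2 / ρ * dist x₀ y = 1 / t := by rw [htdef]; field_simp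
    have h5 : -1 < t * ((f y).toReal - r) := by rw [← hr] at h2; linarith
    have h6 : -(1 / t) < (f y).toReal - r := by
      rw [← neg_div, div_lt_iff₀ ht0]; linarith
    rw [h4]; linarith

theorem exists_lowerBound_rpow_sub_linear (hp : 1 < p) {K b : ℝ} (hK : 0 < K) (hb : 0 ≤ b) :
    ∃ B : ℝ, ∀ s : ℝ, 0 ≤ s → B ≤ K * s ^ p - b * s := by
  -- `R` is the zero of `K * s ^ (p - 1) - b`: beyond it the expression is nonnegative, before it at
  -- least `-(b * R)`.
  set R := (b / K) ^ (1 / (p - 1)) with hR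
  have hbK : 0 ≤ b / K := by positivity
  have hRp : R ^ (p - 1) = b / K := by
    rw [hR, ← Real.rpow_mul hbK, one_div_mul_cancel (by linarith), Real.rpow_one]
  have hR0 : 0 ≤ R := Real.rpow_nonneg hbK _
  refine ⟨-(b * R), fun s hs => ?_⟩
  rcases le_or_gt s R with h | h
  · have h1 : 0 ≤ K * s ^ p := by positivity
    have h2 := mul_le_mul_of_nonneg_left h hb
    linarith
  · have hs0 : 0 < s := hR0.trans_lt h
    have h1 : b / K ≤ s ^ (p - 1) := by
      rw [← hRp]; exact Real.rpow_le_rpow hR0 h.le (by linarith)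
    have h2 : s ^ p = s ^ (p - 1) * s := by
      rw [← Real.rpow_add_one hs0.ne', sub_add_cancel]
    have h3 : b ≤ K * s ^ (p - 1) := by
      rwa [div_le_iff₀ hK, mul_comm] at h1
    have h4 := mul_le_mul_of_nonneg_right h3 hs
    have h5 : 0 ≤ b * R := by positivity
    rw [h2]; linarith

/-- The regularized function is uniformly convex at midpoints. -/
theorem PUniformlyConvex.exists_midpoint (hG : PUniformlyConvex G p c) (hbot : ∀ x, f x ≠ ⊥)
    (hconv : GeodesicallyConvex f) {K : ℝ} (hK : 0 < K) (x : G) {y z : G} (hy : f y ≠ ⊤)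
    (hz : f z ≠ ⊤) :
    ∃ w, f w ≠ ⊤ ∧ (f w).toReal + K * dist w x ^ p ≤
      ((f y).toReal + K * dist y x ^ p) / 2 + ((f z).toReal + K * dist z x ^ p) / 2
        - K * c / 8 * dist y z ^ p := by
  obtain ⟨γ, hγ⟩ := hG.1 y z
  have ht : (1 / 2 : ℝ) ∈ Icc (0 : ℝ) 1 := by norm_num
  obtain ⟨h1, h2⟩ := hconv.real_le hbot hγ ht hy hz
  have h3 := mul_le_mul_of_nonneg_left (hG.2 y z x γ hγ _ ht) hK.le
  refine ⟨_, h1, ?_⟩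
  rw [dist_comm _ x, dist_comm y x, dist_comm z x]
  linarith

theorem add_coe_le_add_coe_iff {a b : EReal} (ha : a ≠ ⊥) (ha' : a ≠ ⊤) (hb : b ≠ ⊥) (hb' : b ≠ ⊤)
    (s t : ℝ) : a + (s : EReal) ≤ b + (t : EReal) ↔ a.toReal + s ≤ b.toReal + t := by
  conv_lhs => rw [← EReal.coe_toReal ha' ha, ← EReal.coe_toReal hb' hb]
  norm_cast

theorem mem_argmin_add_iff {X : Type*} {f : X → EReal} (hbot : ∀ x, f x ≠ ⊥) {x₀ : X}
    (hx₀ : f x₀ ≠ ⊤) (h : X → ℝ) (y : X) :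
    y ∈ argmin (fun z => f z + (h z : EReal)) ↔
      f y ≠ ⊤ ∧ ∀ z, f z ≠ ⊤ → (f y).toReal + h y ≤ (f z).toReal + h z := by
  constructor
  · intro hy
    have hy' : f y ≠ ⊤ := by
      intro htop
      have := hy x₀
      simp only [htop, EReal.top_add_coe, top_le_iff] at this
      rw [← EReal.coe_toReal hx₀ (hbot x₀), ← EReal.coe_add] at this
      exact EReal.coe_ne_top _ this
    exact ⟨hy', fun z hz => (add_coe_le_add_coe_iff (hbot y) hy' (hbot z) hz _ _).1 (hy z)⟩
  · rintro ⟨hy, hmin⟩ z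
    by_cases hz : f z = ⊤
    · simp [hz]
    · exact (add_coe_le_add_coe_iff (hbot y) hy (hbot z) hz _ _).2 (hmin z hz)

/-- Two points with values below `m + δ` have a midpoint of value at least `m`, so the uniform
convexity gain bounds their distance. The infimum `m` is finite because the power `p > 1` dominates
the affine minorant of `f`. -/
theorem exists_minimizer [CompleteSpace G] (hp : 1 < p) (hc : 0 < c) (hG : PUniformlyConvex G p c)
    (hbot : ∀ x, f x ≠ ⊥) (hconv : GeodesicallyConvex f) (hlsc : LowerSemicontinuous f)
    {x₀ : G} (hx₀ : f x₀ ≠ ⊤) {K : ℝ} (hK : 0 < K) (x : G) :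
    ∃ y, f y ≠ ⊤ ∧ ∀ z, f z ≠ ⊤ →
      (f y).toReal + K * dist y x ^ p ≤ (f z).toReal + K * dist z x ^ p := by
  have hp0 : 0 < p := by linarith
  set g : G → ℝ := fun y => (f y).toReal + K * dist y x ^ p with hg
  set S : Set ℝ := g '' {y | f y ≠ ⊤} with hS
  have hne : S.Nonempty := ⟨g x₀, x₀, hx₀, rfl⟩
  have hbdd : BddBelow S := by
    obtain ⟨a, b, hb, hab⟩ := exists_affine_minorant hG.1 hbot hconv hlsc hx₀
    obtain ⟨B, hB⟩ := exists_lowerBound_rpow_sub_linear hp hK hb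
    refine ⟨a - b * dist x₀ x + B, ?_⟩
    rintro _ ⟨y, hy, rfl⟩
    have h1 := hab y hy
    have h2 := hB (dist y x) dist_nonneg
    have h3 := mul_le_mul_of_nonneg_left (dist_triangle_right x₀ y x) hb
    simp only [hg]
    linarith
  set m := sInf S with hm
  have hmle : ∀ y, f y ≠ ⊤ → m ≤ g y := fun y hy => csInf_le hbdd ⟨y, hy, rfl⟩
  have hseq : ∀ n : ℕ, ∃ y, f y ≠ ⊤ ∧ g y < m + 1 / ((n : ℝ) + 1) := by
    intro n
    obtain ⟨_, ⟨y, hy, rfl⟩, hlt⟩ :=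
      Real.lt_sInf_add_pos hne (ε := 1 / ((n : ℝ) + 1)) (by positivity)
    exact ⟨y, hy, hlt⟩
  choose y hytop hylt using hseq
  have hclose : ∀ u v δ, f u ≠ ⊤ → f v ≠ ⊤ → g u < m + δ → g v < m + δ →
      K * c / 8 * dist u v ^ p < δ := by
    intro u v δ hu hv hgu hgv
    obtain ⟨w, hw, hle⟩ := hG.exists_midpoint hbot hconv hK x hu hv
    have := hmle w hw
    simp only [hg] at *
    linarith
  have hcauchy : CauchySeq y := by
    refine Metric.cauchySeq_iff'.2 fun ε hε => ?_
    have hδ : 0 < K * c / 8 * ε ^ p := by positivity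
    obtain ⟨N, hN⟩ := exists_nat_one_div_lt hδ
    refine ⟨N, fun n hn => ?_⟩
    have h1 : 1 / ((n : ℝ) + 1) ≤ 1 / ((N : ℝ) + 1) :=
      one_div_le_one_div_of_le (by positivity) (by exact_mod_cast Nat.succ_le_succ hn)
    have h2 := hclose (y n) (y N) (K * c / 8 * ε ^ p) (hytop n) (hytop N)
      ((hylt n).trans_le (by linarith [hN.le])) ((hylt N).trans_le (by linarith [hN.le]))
    have h3 : dist (y n) (y N) ^ p < ε ^ p := lt_of_mul_lt_mul_left h2 (a := K * c / 8) (by positivity)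
    exact (Real.rpow_lt_rpow_iff dist_nonneg hε.le hp0).1 h3
  obtain ⟨u, hu⟩ := cauchySeq_tendsto_of_complete hcauchy
  have hfu : f u ≤ ((m - K * dist u x ^ p : ℝ) : EReal) := by
    by_contra! hcon
    -- A real `q` strictly between is needed because `f u` is not yet known to be finite.
    obtain ⟨q, hq1, hq2⟩ := EReal.lt_iff_exists_real_btwn.1 hcon
    have hev := hu.eventually (hlsc u _ hq2)
    have hlim : Tendsto (fun n : ℕ => m + 1 / ((n : ℝ) + 1) - K * dist (y n) x ^ p) atTop
        (𝓝 (m + 0 - K * dist u x ^ p)) := by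
      refine (tendsto_const_nhds.add tendsto_one_div_add_atTop_nhds_zero_nat).sub ?_
      exact tendsto_const_nhds.mul
        ((hu.dist tendsto_const_nhds).rpow_const (Or.inr hp0.le))
    have hge : q ≤ m + 0 - K * dist u x ^ p := by
      refine ge_of_tendsto hlim (hev.mono fun n hn => ?_)
      replace hn : (q : EReal) < f (y n) := hn
      rw [← EReal.coe_toReal (hytop n) (hbot _)] at hn
      have h1 : q < (f (y n)).toReal := by exact_mod_cast hn
      have h2 := hylt n
      simp only [hg] at h2
      linarith
    have hq1' : m - K * dist u x ^ p < q := by exact_mod_cast hq1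
    linarith
  have hutop : f u ≠ ⊤ := ne_top_of_le_ne_top (EReal.coe_ne_top _) hfu
  refine ⟨u, hutop, fun z hz => ?_⟩
  rw [← EReal.coe_toReal hutop (hbot u)] at hfu
  have h1 : (f u).toReal ≤ m - K * dist u x ^ p := by exact_mod_cast hfu
  have h2 := hmle z hz
  simp only [hg] at h2
  linarith

theorem minimizer_unique (hc : 0 < c) (hG : PUniformlyConvex G p c)
    (hbot : ∀ x, f x ≠ ⊥) (hconv : GeodesicallyConvex f) {K : ℝ} (hK : 0 < K) (x : G) {y z : G}
    (hy : f y ≠ ⊤ ∧ ∀ w, f w ≠ ⊤ →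
      (f y).toReal + K * dist y x ^ p ≤ (f w).toReal + K * dist w x ^ p)
    (hz : f z ≠ ⊤ ∧ ∀ w, f w ≠ ⊤ →
      (f z).toReal + K * dist z x ^ p ≤ (f w).toReal + K * dist w x ^ p) : y = z := by
  obtain ⟨w, hw, hle⟩ := hG.exists_midpoint hbot hconv hK x hy.1 hz.1
  have h1 := hy.2 w hw
  have h2 := hz.2 w hw
  by_contra hne
  have hd : 0 < dist y z := dist_pos.2 hne
  have : 0 < K * c / 8 * dist y z ^ p := by positivity
  linarith

theorem exists_isProx [CompleteSpace G] {lam : ℝ} (hp : 1 < p) (hc : 0 < c) (hlam : 0 < lam)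
    (hG : PUniformlyConvex G p c) (hf : ProperFun f) (hconv : GeodesicallyConvex f)
    (hlsc : LowerSemicontinuous f) : ∃ T : G → G, IsProx p lam f T := by
  obtain ⟨hbot, x₀, hx₀⟩ := hf
  have hK : 0 < 1 / (p * lam ^ (p - 1)) := by
    have : 0 < p := by linarith
    positivity
  choose T hT using fun x => exists_minimizer hp hc hG hbot hconv hlsc hx₀ hK x
  refine ⟨T, fun x => Set.eq_singleton_iff_unique_mem.2 ⟨?_, fun y hy => ?_⟩⟩
  · exact (mem_argmin_add_iff hbot hx₀ _ _).2 (hT x)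
  · exact minimizer_unique hc hG hbot hconv hK x ((mem_argmin_add_iff hbot hx₀ _ _).1 hy) (hT x)

/-! ### Fixed points, nearest points, and assertions (i) and (ii) -/

section Prox

variable {lam : ℝ} {T : G → G}

theorem IsProx.isMin (hT : IsProx p lam f T) (hf : ProperFun f) (x : G) :
    f (T x) ≠ ⊤ ∧ ∀ z, f z ≠ ⊤ →
      (f (T x)).toReal + 1 / (p * lam ^ (p - 1)) * dist (T x) x ^ p ≤
        (f z).toReal + 1 / (p * lam ^ (p - 1)) * dist z x ^ p := by
  obtain ⟨hbot, x₀, hx₀⟩ := hf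
  refine (mem_argmin_add_iff hbot hx₀ (fun z => 1 / (p * lam ^ (p - 1)) * dist z x ^ p) _).1 ?_
  have := hT x
  rw [proxSet] at this
  rw [this]
  rfl

theorem ProperFun.ne_top_of_mem_argmin {X : Type*} {f : X → EReal} (hf : ProperFun f) {y : X}
    (hy : y ∈ argmin f) : f y ≠ ⊤ := by
  obtain ⟨-, x₀, hx₀⟩ := hf
  exact ne_top_of_le_ne_top hx₀ (hy x₀)

theorem IsProx.eq_of_mem_argmin (hT : IsProx p lam f T) (hp : 1 < p) (hlam : 0 < lam) {y : G}
    (hy : y ∈ argmin f) : T y = y := by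
  have hp0 : 0 < p := by linarith
  have : y ∈ proxSet p lam f y := by
    intro z
    refine add_le_add (hy z) (EReal.coe_le_coe_iff.2 ?_)
    rw [dist_self, Real.zero_rpow hp0.ne', mul_zero]
    positivity
  rw [hT y] at this
  exact this.symm

/-- Moving from `y` a fraction `t` towards `z` changes `f` by at most `t * (f z - f y)` but costs
only order `t ^ p`. Dividing by `t` and letting `t → 0` removes the cost, since `p > 1`. -/
theorem IsProx.mem_argmin_of_eq (hT : IsProx p lam f T) (hp : 1 < p)
    (hgeo : ∀ x y : G, ∃ γ : ℝ → G, IsGeodesic γ x y) (hf : ProperFun f)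
    (hconv : GeodesicallyConvex f) {y : G} (hy : T y = y) : y ∈ argmin f := by
  have hp0 : 0 < p := by linarith
  intro z
  by_cases hz : f z = ⊤
  · simp [hz]
  obtain ⟨hytop, hmin⟩ := hT.isMin hf y
  rw [hy] at hytop hmin
  set K := 1 / (p * lam ^ (p - 1)) with hK
  obtain ⟨γ, hγ⟩ := hgeo y z
  have key : ∀ t ∈ Ioc (0 : ℝ) 1,
      (f y).toReal ≤ (f z).toReal + K * (t ^ (p - 1) * dist y z ^ p) := by
    intro t ht
    have ht' : t ∈ Icc (0 : ℝ) 1 := ⟨ht.1.le, ht.2⟩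
    obtain ⟨h1, h2⟩ := hconv.real_le hf.1 hγ ht' hytop hz
    have h3 := hmin _ h1
    rw [dist_self, Real.zero_rpow hp0.ne', dist_comm, hγ.dist_left ht',
      Real.mul_rpow ht.1.le dist_nonneg] at h3
    have h4 : t ^ p = t * t ^ (p - 1) := by
      rw [mul_comm, ← Real.rpow_add_one ht.1.ne', sub_add_cancel]
    rw [h4] at h3
    refine le_of_mul_le_mul_left ?_ ht.1
    linarith
  have hlim : Tendsto (fun t : ℝ => (f z).toReal + K * (t ^ (p - 1) * dist y z ^ p)) (𝓝[>] 0)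
      (𝓝 ((f z).toReal + K * ((0 : ℝ) ^ (p - 1) * dist y z ^ p))) := by
    refine tendsto_const_nhds.add (tendsto_const_nhds.mul (Tendsto.mul_const _ ?_))
    exact ((Real.continuousAt_rpow_const 0 (p - 1) (Or.inr (by linarith))).tendsto).mono_left
      nhdsWithin_le_nhds
  have hle := ge_of_tendsto hlim (by
    filter_upwards [Ioc_mem_nhdsGT (zero_lt_one' ℝ)] with t ht using key t ht)
  rw [Real.zero_rpow (by linarith : p - 1 ≠ 0), zero_mul, mul_zero, add_zero] at hle
  rw [← EReal.coe_toReal hytop (hf.1 y), ← EReal.coe_toReal hz (hf.1 z)]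
  exact_mod_cast hle

/-- The proximal point of `x` is a nearest point to `x` on each geodesic that joins it to a
minimizer of `f`. -/
theorem IsProx.dist_le_of_isGeodesic (hT : IsProx p lam f T) (hp : 1 < p) (hlam : 0 < lam)
    (hf : ProperFun f) (hconv : GeodesicallyConvex f) {x y : G} (hy : y ∈ argmin f) {γ : ℝ → G}
    (hγ : IsGeodesic γ (T x) y) {t : ℝ} (ht : t ∈ Icc (0 : ℝ) 1) :
    dist x (T x) ≤ dist x (γ t) := by
  have hp0 : 0 < p := by linarith
  obtain ⟨hu, hmin⟩ := hT.isMin hf x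
  have hytop := hf.ne_top_of_mem_argmin hy
  have hle : (f y).toReal ≤ (f (T x)).toReal := EReal.toReal_le_toReal (hy _) (hf.1 y) hu
  obtain ⟨h1, h2⟩ := hconv.real_le hf.1 hγ ht hu hytop
  have h3 := hmin _ h1
  have h4 := mul_le_mul_of_nonneg_left hle ht.1
  have hK : 0 < 1 / (p * lam ^ (p - 1)) := by positivity
  have h5 : dist (T x) x ^ p ≤ dist (γ t) x ^ p := by
    refine le_of_mul_le_mul_left ?_ hK
    linarith
  rw [dist_comm x, dist_comm x]
  exact (Real.rpow_le_rpow_iff dist_nonneg dist_nonneg hp0).1 h5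

theorem IsProx.argmin_eq_fixedPoints (hT : IsProx p lam f T) (hp : 1 < p) (hlam : 0 < lam)
    (hgeo : ∀ x y : G, ∃ γ : ℝ → G, IsGeodesic γ x y) (hf : ProperFun f)
    (hconv : GeodesicallyConvex f) : argmin f = Function.fixedPoints T :=
  Set.ext fun _ => ⟨hT.eq_of_mem_argmin hp hlam, hT.mem_argmin_of_eq hp hgeo hf hconv⟩

theorem IsProx.quasiStrictlyNonexpansive (hT : IsProx p lam f T) (hp : 1 < p) (hc : 0 < c)
    (hlam : 0 < lam) (hG : PUniformlyConvex G p c) (hf : ProperFun f)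
    (hconv : GeodesicallyConvex f) (hsymm : SymmetricPerpendicular G) :
    QuasiStrictlyNonexpansive T := by
  intro x hx y hy
  have hp0 : 0 < p := by linarith
  have hy' : y ∈ argmin f := hT.mem_argmin_of_eq hp hG.1 hf hconv hy
  obtain ⟨γ, hγ⟩ := hG.1 (T x) y
  obtain ⟨η, hη⟩ := hG.1 (T x) x
  have h0 : (0 : ℝ) ∈ Icc (0 : ℝ) 1 := ⟨le_rfl, zero_le_one⟩
  have h1 : (1 : ℝ) ∈ Icc (0 : ℝ) 1 := ⟨zero_le_one, le_rfl⟩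
  have h12 : (1 / 2 : ℝ) ∈ Icc (0 : ℝ) 1 := by norm_num
  have hperp : PerpAt (η '' Icc (0 : ℝ) 1) (γ '' Icc (0 : ℝ) 1) (T x) := by
    -- Nearness is known only for the endpoint `x`; it passes to `η s` because `d(x, Tx) = d(x, η s)
    -- + d(η s, Tx)`.
    rintro _ ⟨s, hs, rfl⟩ _ ⟨t, ht, rfl⟩
    have e1 := hη.dist_left hs
    have e2 := hη.dist_right hs
    have e3 := hT.dist_le_of_isGeodesic hp hlam hf hconv hy' hγ ht
    have e4 := dist_triangle x (η s) (γ t)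
    rw [dist_comm x (η s)] at e4
    rw [dist_comm x (T x)] at e3
    rw [dist_comm (η s) (T x)]
    linarith
  have hperp' := (hsymm _ _ ⟨_, _, η, hη, rfl⟩ ⟨_, _, γ, hγ, rfl⟩ (T x)
    ⟨⟨0, h0, hη.1⟩, ⟨0, h0, hγ.1⟩⟩).1 hperp
  have hmid := hperp' y ⟨1, h1, hγ.2.1⟩ (η (1 / 2)) ⟨_, h12, rfl⟩
  have e1 := Real.rpow_le_rpow dist_nonneg hmid hp0.le
  have e2 := hG.2 _ _ y η hη _ h12
  have hd : 0 < dist (T x) x := dist_pos.2 hx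
  have e3 : 0 < c * dist (T x) x ^ p := by positivity
  rw [dist_comm (T x) y, dist_comm x y]
  refine (Real.rpow_lt_rpow_iff dist_nonneg dist_nonneg hp0).1 ?_
  linarith

/-- A nearest point on a segment satisfies a Pythagorean type inequality. -/
theorem PUniformlyConvex.rpow_add_le (hG : PUniformlyConvex G p c) (hp : 0 < p) {x u y : G}
    {γ : ℝ → G} (hγ : IsGeodesic γ u y) (hnear : ∀ t ∈ Icc (0 : ℝ) 1, dist x u ≤ dist x (γ t)) :
    c / 2 * dist u y ^ p + dist x u ^ p ≤ dist x y ^ p := by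
  have key : ∀ t ∈ Ioc (0 : ℝ) 1,
      c / 2 * (1 - t) * dist u y ^ p + dist x u ^ p ≤ dist x y ^ p := by
    intro t ht
    have ht' : t ∈ Icc (0 : ℝ) 1 := ⟨ht.1.le, ht.2⟩
    have h1 := Real.rpow_le_rpow dist_nonneg (hnear t ht') hp.le
    have h2 := hG.2 _ _ x γ hγ t ht'
    -- After cancelling `d(x,u)^p`, every remaining term carries a factor `t`.
    refine le_of_mul_le_mul_left ?_ ht.1
    linarith
  have hlim : Tendsto (fun t : ℝ => c / 2 * (1 - t) * dist u y ^ p + dist x u ^ p) (𝓝[>] 0)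
      (𝓝 (c / 2 * (1 - 0) * dist u y ^ p + dist x u ^ p)) := by
    refine (Continuous.tendsto ?_ 0).mono_left nhdsWithin_le_nhds
    fun_prop
  have hle := le_of_tendsto hlim (by
    filter_upwards [Ioc_mem_nhdsGT (zero_lt_one' ℝ)] with t ht using key t ht)
  simpa using hle

theorem transportDiscrepancy_of_fixed (hp : 0 < p) (a : ℝ) {x y : G} (hy : T y = y) :
    transportDiscrepancy p a T x y = a / 2 * dist (T x) x ^ p := by
  rw [transportDiscrepancy, hy, dist_self, Real.zero_rpow hp.ne']
  ring

theorem IsProx.almostFirmlyNonexpansiveAt (hT : IsProx p lam f T) (hp : 1 < p)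
    (hc2 : c ≤ 2) (hlam : 0 < lam) (hG : PUniformlyConvex G p c) (hf : ProperFun f)
    (hconv : GeodesicallyConvex f) (hc1 : 1 < c) {y : G} (hy : y ∈ argmin f) :
    AlmostFirmlyNonexpansiveAt p c (c * (c - 1) / (c * (c - 1) + 2)) ((2 - c) / (c - 1)) T
      univ y := by
  have hp0 : 0 < p := by linarith
  have hc0 : 0 < c := by linarith
  have hcp : 0 < c - 1 := by linarith
  have hcc : 0 < c * (c - 1) := by positivity
  refine ⟨⟨by positivity, by rw [div_lt_one (by positivity)]; linarith⟩,
    div_nonneg (by linarith) hcp.le, mem_univ y, fun x _ => ?_⟩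
  have hTy := hT.eq_of_mem_argmin hp hlam hy
  obtain ⟨γ, hγ⟩ := hG.1 (T x) y
  have h1 := hG.rpow_add_le hp0 hγ
    fun t ht => hT.dist_le_of_isGeodesic hp hlam hf hconv hy hγ ht
  rw [transportDiscrepancy_of_fixed hp0 c hTy, hTy]
  have e1 : (1 - c * (c - 1) / (c * (c - 1) + 2)) / (c * (c - 1) / (c * (c - 1) + 2))
      = 2 / (c * (c - 1)) := by field_simp; ring
  have e2 : 1 + (2 - c) / (c - 1) = 1 / (c - 1) := by field_simp; ring
  have e3 : 2 / (c * (c - 1)) * (c / 2 * dist (T x) x ^ p) = 1 / (c - 1) * dist (T x) x ^ p := by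
    field_simp
  rw [e1, e2, e3, ← mul_sub, one_div, inv_mul_eq_div, le_div_iff₀ hcp]
  -- It remains to replace the coefficient `c/2` in `h1` by `c - 1`, which is no larger because `c ≤
  -- 2`.
  have h2 : 0 ≤ dist (T x) y ^ p := by positivity
  rw [dist_comm x (T x)] at h1
  nlinarith

end Prox
end PProx

namespace PProx

variable {G : Type*} [MetricSpace G] {p c : ℝ}

/-! ### Exponents below two -/

theorem sq_rpow_half (p : ℝ) {a : ℝ} (ha : 0 ≤ a) : (a ^ 2) ^ (p / 2) = a ^ p := by
  rw [← Real.rpow_natCast a 2, ← Real.rpow_mul ha]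
  congr 1
  push_cast
  ring

/-- The second difference of a power is of order `h ^ 2`, which is negligible against `h ^ p` for `p
< 2`. The bound `4 * h ^ 2` comes from concavity of `s ^ (p / 2)` and Bernoulli's inequality. -/
theorem exists_secondDifference_rpow_lt (hp : 1 < p) (hp2 : p < 2) {C : ℝ} (hC : 0 < C) :
    ∃ h ∈ Ioo (0 : ℝ) (1 / 2), (1 - 2 * h) ^ p / 2 + 1 / 2 - (1 - h) ^ p < C * h ^ p := by
  have hlim : Tendsto (fun h : ℝ => h ^ (2 - p)) (𝓝[>] 0) (𝓝 ((0 : ℝ) ^ (2 - p))) :=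
    ((Real.continuousAt_rpow_const 0 (2 - p) (Or.inr (by linarith))).tendsto).mono_left
      nhdsWithin_le_nhds
  rw [Real.zero_rpow (by linarith : 2 - p ≠ 0)] at hlim
  obtain ⟨h, hsmall, h0, h2⟩ := ((hlim.eventually_lt_const (by positivity : 0 < C / 4)).and
    (Ioo_mem_nhdsGT (by norm_num : (0 : ℝ) < 1 / 2))).exists
  refine ⟨h, ⟨h0, h2⟩, ?_⟩
  have h1 : 0 < 1 - h := by linarith
  have hq0 : 0 ≤ p / 2 := by linarith
  have hq1 : p / 2 ≤ 1 := by linarith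
  have hconc := (Real.concaveOn_rpow hq0 hq1).2 (x := (1 - 2 * h) ^ 2) (y := 1)
    (mem_Ici.2 (by positivity)) (mem_Ici.2 zero_le_one)
    (by norm_num : (0 : ℝ) ≤ 1 / 2) (by norm_num : (0 : ℝ) ≤ 1 / 2) (by norm_num)
  simp only [smul_eq_mul, Real.one_rpow] at hconc
  rw [sq_rpow_half p (by linarith)] at hconc
  set w := (h / (1 - h)) ^ 2 with hw
  have hw0 : 0 ≤ w := by positivity
  have hw4 : w ≤ 4 * h ^ 2 := by
    have : h / (1 - h) ≤ 2 * h := by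
      rw [div_le_iff₀ h1]; nlinarith
    calc w ≤ (2 * h) ^ 2 := by rw [hw]; gcongr
      _ = 4 * h ^ 2 := by ring
  have hmean : 1 / 2 * (1 - 2 * h) ^ 2 + 1 / 2 * 1 = (1 - h) ^ 2 * (1 + w) := by
    rw [hw]; field_simp; ring
  rw [hmean, Real.mul_rpow (by positivity) (by positivity), sq_rpow_half p h1.le] at hconc
  have hbern := rpow_one_add_le_one_add_mul_self (by linarith : -1 ≤ w) hq0 hq1
  have hP1 : (1 - h) ^ p ≤ 1 := Real.rpow_le_one h1.le (by linarith) (by linarith)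
  have hP0 : 0 ≤ (1 - h) ^ p := by positivity
  have e1 := mul_le_mul_of_nonneg_left hbern hP0
  have e2 : (1 - h) ^ p * (p / 2 * w) ≤ 1 * (1 * (4 * h ^ 2)) := by gcongr
  have e3 : h ^ 2 = h ^ (2 - p) * h ^ p := by
    rw [← Real.rpow_natCast h 2, ← Real.rpow_add h0]
    congr 1
    push_cast
    ring
  have hhp : 0 < h ^ p := by positivity
  have e4 := mul_lt_mul_of_pos_right hsmall hhp
  linarith

theorem IsGeodesic.comp_affine {γ : ℝ → G} {x y : G} (hγ : IsGeodesic γ x y) {a b : ℝ}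
    (ha : 0 ≤ a) (hab : a ≤ b) (hb : b ≤ 1) :
    IsGeodesic (fun t => γ (a + (b - a) * t)) (γ a) (γ b) := by
  have hmem : ∀ t ∈ Icc (0 : ℝ) 1, a + (b - a) * t ∈ Icc (0 : ℝ) 1 := by
    intro t ht
    have h1 := mul_nonneg (sub_nonneg.2 hab) ht.1
    have h2 := mul_le_mul_of_nonneg_left ht.2 (sub_nonneg.2 hab)
    constructor <;> linarith
  refine ⟨by simp, by simp, fun s hs t ht => ?_⟩
  rw [hγ.2.2 _ (hmem s hs) _ (hmem t ht), hγ.2.2 a ⟨ha, hab.trans hb⟩ b ⟨ha.trans hab, hb⟩,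
    show a + (b - a) * s - (a + (b - a) * t) = (s - t) * (b - a) by ring, abs_mul,
    abs_sub_comm b a, mul_assoc]

/-- Nontrivial geodesic spaces are never `p`-uniformly convex for `p < 2`. -/
theorem PUniformlyConvex.subsingleton_of_lt_two (hG : PUniformlyConvex G p c) (hp : 1 < p)
    (hp2 : p < 2) (hc : 0 < c) : Subsingleton G := by
  refine ⟨fun x y => ?_⟩
  by_contra hne
  have hD : 0 < dist x y := dist_pos.2 hne
  obtain ⟨γ, hγ⟩ := hG.1 x y
  obtain ⟨h, ⟨h0, h2⟩, hlt⟩ :=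
    exists_secondDifference_rpow_lt hp hp2 (by positivity : 0 < c / 8 * 2 ^ p)
  -- Uniform convexity is tested on a short piece at the end of `γ`, as seen from its starting point
  -- `x`: distances to `x` are then linear in the parameter, with vanishing second difference.
  have hsub := hγ.comp_affine (a := 1 - 2 * h) (b := 1) (by linarith) (by linarith) le_rfl
  have key := hG.2 _ _ x _ hsub (1 / 2) (by norm_num)
  rw [show 1 - 2 * h + (1 - (1 - 2 * h)) * (1 / 2) = 1 - h by ring,
    hγ.dist_left (t := 1 - h) ⟨by linarith, by linarith⟩,
    hγ.dist_left (t := 1 - 2 * h) ⟨by linarith, by linarith⟩, hγ.2.1,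
    hγ.dist_right (t := 1 - 2 * h) ⟨by linarith, by linarith⟩,
    show 1 - (1 - 2 * h) = 2 * h by ring,
    Real.mul_rpow (by linarith) hD.le, Real.mul_rpow (by linarith) hD.le,
    Real.mul_rpow (by linarith) hD.le, Real.mul_rpow (by norm_num) h0.le] at key
  have hDp : 0 < dist x y ^ p := by positivity
  have := mul_lt_mul_of_pos_right hlt hDp
  linarith

/-! ### Pythagorean inequalities in the model planes -/

theorem deriv_nonpos_of_le_right {F : ℝ → ℝ} {F' : ℝ} (hF : HasDerivAt F F' 0)
    (hle : ∀ s ∈ Icc (0 : ℝ) 1, F s ≤ F 0) : F' ≤ 0 := by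
  refine le_of_tendsto hF.tendsto_slope_zero_right ?_
  filter_upwards [Ioc_mem_nhdsGT (zero_lt_one' ℝ)] with t ht
  have := hle t ⟨ht.1.le, ht.2⟩
  rw [zero_add, smul_eq_mul]
  exact mul_nonpos_of_nonneg_of_nonpos (inv_nonneg.2 ht.1.le) (by linarith)

section Sphere

open InnerProductGeometry

variable {E : Type*} [NormedAddCommGroup E] [InnerProductSpace ℝ E]

theorem inner_eq_cos_angle {u v : E} (hu : ‖u‖ = 1) (hv : ‖v‖ = 1) :
    inner ℝ u v = Real.cos (angle u v) := by
  rw [cos_angle, hu, hv, mul_one, div_one]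

/-- The points of the arc between two unit vectors that are neither equal nor opposite. -/
theorem exists_unit_arc {u y : E} (hu : ‖u‖ = 1) (hy : ‖y‖ = 1) (hθ : Real.sin (angle u y) ≠ 0)
    {s : ℝ} (hs : s ∈ Icc (0 : ℝ) 1) :
    ∃ a : E, ‖a‖ = 1 ∧ angle u a = s * angle u y ∧ angle a y = (1 - s) * angle u y ∧
      ∀ x : E, Real.sin (angle u y) * inner ℝ a x =
        Real.sin ((1 - s) * angle u y) * inner ℝ u x + Real.sin (s * angle u y) * inner ℝ y x := by
  set θ := angle u y with hθdef
  have hθ0 : 0 ≤ θ := angle_nonneg u y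
  have hθπ : θ ≤ Real.pi := angle_le_pi u y
  have huy : inner ℝ u y = Real.cos θ := inner_eq_cos_angle hu hy
  have huu : inner ℝ u u = (1 : ℝ) := by rw [real_inner_self_eq_norm_sq, hu]; norm_num
  have hyy : inner ℝ y y = (1 : ℝ) := by rw [real_inner_self_eq_norm_sq, hy]; norm_num
  have hA0 : 0 ≤ (1 - s) * θ := mul_nonneg (by linarith [hs.2]) hθ0
  have hB0 : 0 ≤ s * θ := mul_nonneg hs.1 hθ0
  have hsum : (1 - s) * θ + s * θ = θ := by ring
  set A := (1 - s) * θ with hA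
  set B := s * θ with hB
  have hsinθ : Real.sin θ = Real.sin A * Real.cos B + Real.cos A * Real.sin B := by
    rw [← hsum, Real.sin_add]
  have hcosθ : Real.cos θ = Real.cos A * Real.cos B - Real.sin A * Real.sin B := by
    rw [← hsum, Real.cos_add]
  have hA2 := Real.sin_sq_add_cos_sq A
  have hB2 := Real.sin_sq_add_cos_sq B
  -- Spherical linear interpolation; the addition theorems give its inner products with `u` and `y`.
  set a : E := (Real.sin θ)⁻¹ • (Real.sin A • u + Real.sin B • y) with ha
  have hax : ∀ x : E, Real.sin θ * inner ℝ a x =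
      Real.sin A * inner ℝ u x + Real.sin B * inner ℝ y x := by
    intro x
    rw [ha, real_inner_smul_left, inner_add_left, real_inner_smul_left, real_inner_smul_left,
      mul_inv_cancel_left₀ hθ]
  have hau : inner ℝ a u = Real.cos B := by
    refine mul_left_cancel₀ hθ ?_
    rw [hax, huu, real_inner_comm u y, huy, hsinθ, hcosθ]
    linear_combination (-Real.sin A) * hB2
  have hay : inner ℝ a y = Real.cos A := by
    refine mul_left_cancel₀ hθ ?_
    rw [hax, hyy, huy, hsinθ, hcosθ]
    linear_combination (-Real.sin B) * hA2
  have haa : inner ℝ a a = (1 : ℝ) := by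
    refine mul_left_cancel₀ hθ ?_
    rw [hax, real_inner_comm, hau, real_inner_comm, hay, hsinθ]
    ring
  have hna : ‖a‖ = 1 := by
    rw [real_inner_self_eq_norm_sq] at haa
    exact (pow_eq_one_iff_of_nonneg (norm_nonneg a) two_ne_zero).1 haa
  refine ⟨a, hna, ?_, ?_, hax⟩
  · rw [angle_comm, angle, hau, hna, hu, mul_one, div_one, Real.arccos_cos hB0 (by linarith)]
  · rw [angle, hay, hna, hy, mul_one, div_one, Real.arccos_cos hA0 (by linarith)]

/-- Along the arc, the cosine of the distance to `x` is maximal at `u`. By the interpolation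
formula, its derivative there is a positive multiple of the difference of the two sides. -/
theorem cos_angle_le_of_nearest {u y x : E} (hu : ‖u‖ = 1) (hy : ‖y‖ = 1) (hx : ‖x‖ = 1)
    (h0 : 0 < angle u y) (hπ : angle u y < Real.pi)
    (hnear : ∀ s ∈ Icc (0 : ℝ) 1, ∀ a : E, ‖a‖ = 1 → angle u a = s * angle u y →
      angle a y = (1 - s) * angle u y → angle x u ≤ angle a x) :
    Real.cos (angle y x) ≤ Real.cos (angle u y) * Real.cos (angle x u) := by
  have hsin : 0 < Real.sin (angle u y) := Real.sin_pos_of_pos_of_lt_pi h0 hπ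
  set θ := angle u y with hθ
  set F : ℝ → ℝ := fun s => Real.sin ((1 - s) * θ) * Real.cos (angle x u) +
    Real.sin (s * θ) * Real.cos (angle y x) with hF
  have hder : HasDerivAt F (Real.cos ((1 - 0) * θ) * (-1 * θ) * Real.cos (angle x u) +
      Real.cos (0 * θ) * (1 * θ) * Real.cos (angle y x)) 0 := by
    have h1 : HasDerivAt (fun s : ℝ => (1 - s) * θ) (-1 * θ) 0 :=
      ((hasDerivAt_id (0 : ℝ)).const_sub 1).mul_const θ
    have h2 : HasDerivAt (fun s : ℝ => s * θ) (1 * θ) 0 := (hasDerivAt_id (0 : ℝ)).mul_const θ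
    exact (h1.sin.mul_const _).add (h2.sin.mul_const _)
  have hle := deriv_nonpos_of_le_right hder (by
    intro s hs
    obtain ⟨a, ha, hua, hay, hin⟩ := exists_unit_arc hu hy hsin.ne' hs
    have h1 := hnear s hs a ha hua hay
    have h2 := Real.cos_le_cos_of_nonneg_of_le_pi (angle_nonneg x u) (angle_le_pi a x) h1
    have h3 := hin x
    rw [inner_eq_cos_angle ha hx, inner_eq_cos_angle hu hx, inner_eq_cos_angle hy hx,
      angle_comm u x] at h3
    have h4 := mul_le_mul_of_nonneg_left h2 hsin.le
    simp only [hF, sub_zero, one_mul, zero_mul, Real.sin_zero, add_zero]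
    linarith)
  simp only [sub_zero, one_mul, zero_mul, Real.cos_zero] at hle
  refine le_of_mul_le_mul_left ?_ h0
  linarith

end Sphere

section Hyperbolic

open UpperHalfPlane

/-- The coordinates `(1/im, re/im, (re^2 + im^2)/im)` place the half-plane on a hyperboloid, making
`cosh` of the distance bilinear. Segments are then interpolated linearly, as on the sphere. -/
theorem cosh_dist_eq_lorentz (z w : ℍ) : Real.cosh (dist z w) =
    ((1 / z.im) * ((w.re ^ 2 + w.im ^ 2) / w.im) + ((z.re ^ 2 + z.im ^ 2) / z.im) * (1 / w.im)) / 2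
      - (z.re / z.im) * (w.re / w.im) := by
  have hz := z.im_pos.ne'
  have hw := w.im_pos.ne'
  rw [UpperHalfPlane.cosh_dist']
  field_simp
  ring

/-- The points of the segment between two points of the hyperbolic plane. -/
theorem exists_hyperbolic_segment {u y : ℍ} (hθ : 0 < dist u y) {s : ℝ}
    (hs : s ∈ Icc (0 : ℝ) 1) :
    ∃ a : ℍ, dist u a = s * dist u y ∧ dist a y = (1 - s) * dist u y ∧
      ∀ x : ℍ, Real.sinh (dist u y) * Real.cosh (dist a x) =
        Real.sinh ((1 - s) * dist u y) * Real.cosh (dist u x) +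
          Real.sinh (s * dist u y) * Real.cosh (dist y x) := by
  have huy : Real.cosh (dist u y) = Real.cosh (dist u y) := rfl
  conv_lhs at huy => rw [cosh_dist_eq_lorentz]
  set θ := dist u y with hθdef
  have hsinh : 0 < Real.sinh θ := Real.sinh_pos_iff.2 hθ
  have hA0 : 0 ≤ (1 - s) * θ := mul_nonneg (by linarith [hs.2]) hθ.le
  have hB0 : 0 ≤ s * θ := mul_nonneg hs.1 hθ.le
  have hsum : (1 - s) * θ + s * θ = θ := by ring
  set A := (1 - s) * θ with hA
  set B := s * θ with hB
  have hSA : 0 ≤ Real.sinh A := Real.sinh_nonneg_iff.2 hA0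
  have hSB : 0 ≤ Real.sinh B := Real.sinh_nonneg_iff.2 hB0
  have hsθ : Real.sinh θ = Real.sinh A * Real.cosh B + Real.cosh A * Real.sinh B := by
    rw [← hsum, Real.sinh_add]
  have hcθ : Real.cosh θ = Real.cosh A * Real.cosh B + Real.sinh A * Real.sinh B := by
    rw [← hsum, Real.cosh_add]
  have hA2 := Real.cosh_sq A
  have hB2 := Real.cosh_sq B
  have hu := u.im_pos
  have hy := y.im_pos
  have huL : (1 / u.im) * ((u.re ^ 2 + u.im ^ 2) / u.im) - (u.re / u.im) ^ 2 = 1 := by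
    field_simp; ring
  have hyL : (1 / y.im) * ((y.re ^ 2 + y.im ^ 2) / y.im) - (y.re / y.im) ^ 2 = 1 := by
    field_simp; ring
  set S := Real.sinh θ with hS
  set V0 := (Real.sinh A * (1 / u.im) + Real.sinh B * (1 / y.im)) / S with hV0
  set V1 := (Real.sinh A * (u.re / u.im) + Real.sinh B * (y.re / y.im)) / S with hV1
  set V2 := (Real.sinh A * ((u.re ^ 2 + u.im ^ 2) / u.im) +
    Real.sinh B * ((y.re ^ 2 + y.im ^ 2) / y.im)) / S with hV2
  have hV0pos : 0 < V0 := by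
    have : 0 < Real.sinh A * (1 / u.im) + Real.sinh B * (1 / y.im) := by
      rcases hs.1.eq_or_lt with h | h
      · have : 0 < Real.sinh A := Real.sinh_pos_iff.2 (by rw [hA, ← h]; linarith)
        positivity
      · have : 0 < Real.sinh B := Real.sinh_pos_iff.2 (by rw [hB]; positivity)
        positivity
    positivity
  have e0 : S * V0 = Real.sinh A * (1 / u.im) + Real.sinh B * (1 / y.im) := by
    rw [hV0]; field_simp
  have e1 : S * V1 = Real.sinh A * (u.re / u.im) + Real.sinh B * (y.re / y.im) := by
    rw [hV1]; field_simp
  have e2 : S * V2 = Real.sinh A * ((u.re ^ 2 + u.im ^ 2) / u.im) +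
    Real.sinh B * ((y.re ^ 2 + y.im ^ 2) / y.im) := by
    rw [hV2]; field_simp
  -- The interpolated vector lies on the hyperboloid, so it comes from the point of the half-plane
  -- with `im = 1/V0` and `re = V1/V0`.
  have hform : V0 * V2 - V1 ^ 2 = 1 := by
    refine mul_left_cancel₀ (pow_ne_zero 2 hsinh.ne') ?_
    have : S ^ 2 * (V0 * V2 - V1 ^ 2) = (S * V0) * (S * V2) - (S * V1) ^ 2 := by ring
    rw [this, e0, e1, e2]
    generalize 1 / u.im = u0 at *
    generalize 1 / y.im = y0 at *
    generalize u.re / u.im = u1 at *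
    generalize y.re / y.im = y1 at *
    generalize (u.re ^ 2 + u.im ^ 2) / u.im = u2 at *
    generalize (y.re ^ 2 + y.im ^ 2) / y.im = y2 at *
    rw [hcθ] at huy
    rw [mul_one, hsθ]
    linear_combination Real.sinh A ^ 2 * huL + Real.sinh B ^ 2 * hyL +
      2 * Real.sinh A * Real.sinh B * huy - Real.sinh A ^ 2 * hB2 - Real.sinh B ^ 2 * hA2
  set a : ℍ := ⟨⟨V1 / V0, 1 / V0⟩, by positivity⟩ with ha
  have hare : a.re = V1 / V0 := rfl
  have haim : a.im = 1 / V0 := rfl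
  have hax : ∀ x : ℍ, S * Real.cosh (dist a x) =
      Real.sinh A * Real.cosh (dist u x) + Real.sinh B * Real.cosh (dist y x) := by
    intro x
    have a0 : 1 / a.im = V0 := by rw [haim]; field_simp
    have a1 : a.re / a.im = V1 := by rw [haim, hare]; field_simp
    have a2 : (a.re ^ 2 + a.im ^ 2) / a.im = V2 := by
      rw [haim, hare]; field_simp; linarith
    rw [cosh_dist_eq_lorentz a x, cosh_dist_eq_lorentz u x, cosh_dist_eq_lorentz y x, a0, a1, a2]
    linear_combination ((x.re ^ 2 + x.im ^ 2) / x.im / 2) * e0 - (x.re / x.im) * e1 +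
      (1 / x.im / 2) * e2
  have hdist : ∀ (z : ℍ) (t : ℝ), 0 ≤ t → S * Real.cosh (dist a z) = S * Real.cosh t →
      dist a z = t := by
    intro z t ht h
    have h1 := mul_left_cancel₀ hsinh.ne' h
    exact Real.cosh_strictMonoOn.injOn (mem_Ici.2 dist_nonneg) (mem_Ici.2 ht) h1
  refine ⟨a, ?_, ?_, hax⟩
  · rw [dist_comm]
    refine hdist u B hB0 ?_
    rw [hax, dist_self, Real.cosh_zero, dist_comm y u, ← hθdef, hsθ, hcθ]
    linear_combination (-Real.sinh A) * hB2
  · refine hdist y A hA0 ?_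
    rw [hax, dist_self, Real.cosh_zero, ← hθdef, hsθ, hcθ]
    linear_combination (-Real.sinh B) * hA2

theorem cosh_dist_ge_of_nearest {u y x : ℍ} (h0 : 0 < dist u y)
    (hnear : ∀ s ∈ Icc (0 : ℝ) 1, ∀ a : ℍ, dist u a = s * dist u y →
      dist a y = (1 - s) * dist u y → dist x u ≤ dist a x) :
    Real.cosh (dist u y) * Real.cosh (dist x u) ≤ Real.cosh (dist y x) := by
  have hsinh : 0 < Real.sinh (dist u y) := Real.sinh_pos_iff.2 h0
  set θ := dist u y with hθ
  set F : ℝ → ℝ := fun s => -(Real.sinh ((1 - s) * θ) * Real.cosh (dist x u) +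
    Real.sinh (s * θ) * Real.cosh (dist y x)) with hF
  have hder : HasDerivAt F (-(Real.cosh ((1 - 0) * θ) * (-1 * θ) * Real.cosh (dist x u) +
      Real.cosh (0 * θ) * (1 * θ) * Real.cosh (dist y x))) 0 := by
    have h1 : HasDerivAt (fun s : ℝ => (1 - s) * θ) (-1 * θ) 0 :=
      ((hasDerivAt_id (0 : ℝ)).const_sub 1).mul_const θ
    have h2 : HasDerivAt (fun s : ℝ => s * θ) (1 * θ) 0 := (hasDerivAt_id (0 : ℝ)).mul_const θ
    exact ((h1.sinh.mul_const _).add (h2.sinh.mul_const _)).neg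
  have hle := deriv_nonpos_of_le_right hder (by
    intro s hs
    obtain ⟨a, hua, hay, hin⟩ := exists_hyperbolic_segment h0 hs
    have h1 := hnear s hs a hua hay
    have h2 : Real.cosh (dist x u) ≤ Real.cosh (dist a x) := by
      rw [Real.cosh_le_cosh, abs_of_nonneg dist_nonneg, abs_of_nonneg dist_nonneg]
      exact h1
    have h3 := hin x
    rw [dist_comm u x] at h3
    have h4 := mul_le_mul_of_nonneg_left h2 hsinh.le
    simp only [hF, sub_zero, one_mul, zero_mul, Real.sinh_zero, add_zero]
    linarith)
  simp only [sub_zero, one_mul, zero_mul, Real.cosh_zero] at hle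
  refine le_of_mul_le_mul_left ?_ h0
  linarith

end Hyperbolic

theorem sq_add_sq_le_of_nearest {E : Type*} [NormedAddCommGroup E] [InnerProductSpace ℝ E]
    {u y x : E} (hnear : ∀ s ∈ Icc (0 : ℝ) 1, ∀ a : E, dist u a = s * dist u y →
      dist a y = (1 - s) * dist u y → dist x u ≤ dist a x) :
    dist u y ^ 2 + dist x u ^ 2 ≤ dist y x ^ 2 := by
  have hexp : ∀ s : ℝ, ‖(x - u) - s • (y - u)‖ ^ 2 =
      ‖x - u‖ ^ 2 - 2 * (s * inner ℝ (x - u) (y - u)) + s ^ 2 * ‖y - u‖ ^ 2 := by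
    intro s
    rw [norm_sub_sq_real, real_inner_smul_right, norm_smul, mul_pow, Real.norm_eq_abs, sq_abs]
  set i : ℝ := inner ℝ (x - u) (y - u) with hi
  have hder : HasDerivAt (fun s : ℝ => 2 * (s * i) - s ^ 2 * ‖y - u‖ ^ 2) (2 * i) 0 := by
    have h1 : HasDerivAt (fun s : ℝ => s * i) (1 * i) 0 := (hasDerivAt_id (0 : ℝ)).mul_const i
    have h2 := ((hasDerivAt_pow 2 (0 : ℝ)).mul_const (‖y - u‖ ^ 2))
    have h3 := (h1.const_mul 2).fun_sub h2
    simpa using h3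
  have hle := deriv_nonpos_of_le_right hder (by
    intro s hs
    have h1 := hnear s hs (u + s • (y - u))
      (by rw [dist_self_add_right, norm_smul, Real.norm_eq_abs, abs_of_nonneg hs.1,
        dist_comm, dist_eq_norm])
      (by
        rw [dist_comm, dist_eq_norm, show y - (u + s • (y - u)) = (1 - s) • (y - u) by module,
          norm_smul, Real.norm_eq_abs, abs_of_nonneg (by linarith [hs.2]), dist_comm u y,
          dist_eq_norm])
    rw [dist_comm _ x, dist_eq_norm, dist_eq_norm, ← sub_sub] at h1
    have h2 := pow_le_pow_left₀ (norm_nonneg _) h1 2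
    rw [hexp] at h2
    simp only [zero_mul, mul_zero, ne_eq, OfNat.ofNat_ne_zero, not_false_eq_true, zero_pow,
      sub_zero]
    linarith)
  have h1 := hexp 1
  rw [one_smul, sub_sub_sub_cancel_right] at h1
  rw [dist_comm u y, dist_comm y x, dist_eq_norm, dist_eq_norm, dist_eq_norm, h1]
  linarith

/-! ### From the curved inequalities to an almost Euclidean one -/

theorem sq_add_sq_le_of_cos_le {a b c : ℝ} (ha : 0 ≤ a) (hb : 0 ≤ b) (hac : a ≤ 2 * c)
    (hbc : b ≤ c) (hc : 3 * c ≤ 1) (h : Real.cos c ≤ Real.cos a * Real.cos b) :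
    a ^ 2 + b ^ 2 ≤ c ^ 2 + 10 * c ^ 4 := by
  -- The Taylor error is at most `(5/96) * (3c)^4`, below `5 * c^4`. It is used at `a + b` and `a -
  -- b`, since `2 cos a cos b = cos (a + b) + cos (a - b)`.
  have hbound : ∀ t : ℝ, |t| ≤ 3 * c → Real.cos t ≤ 1 - t ^ 2 / 2 + 5 * c ^ 4 := by
    intro t ht
    have h1 := (abs_le.1 (Real.cos_bound (ht.trans hc))).2
    have h2 : |t| ^ 4 ≤ (3 * c) ^ 4 := pow_le_pow_left₀ (abs_nonneg t) ht 4
    have h3 : 0 ≤ c ^ 4 := by positivity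
    nlinarith
  have h1 := hbound (a + b) (by rw [abs_of_nonneg (by positivity)]; linarith)
  have h2 := hbound (a - b) (by rw [abs_le]; constructor <;> linarith)
  have h3 := Real.one_sub_sq_div_two_le_cos (x := c)
  rw [Real.cos_add] at h1
  rw [Real.cos_sub] at h2
  linarith

theorem one_add_sq_half_le_cosh (x : ℝ) : 1 + x ^ 2 / 2 ≤ Real.cosh x := by
  have h1 : Real.cosh x = 1 + 2 * Real.sinh (x / 2) ^ 2 := by
    have := Real.cosh_two_mul (x / 2)
    rw [mul_div_cancel₀ x two_ne_zero, Real.cosh_sq] at this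
    linarith
  have h2 : (x / 2) ^ 2 ≤ Real.sinh (x / 2) ^ 2 := by
    refine sq_le_sq.2 ?_
    rw [Real.abs_sinh]
    exact Real.self_le_sinh_iff.2 (abs_nonneg _)
  linarith

/-- Squeeze between `1 + x^2/2 ≤ cosh x` and `cosh c ≤ exp (c^2/2) ≤ 1 + c^2/2 + c^4/4`. The
constant 10 is generous, chosen to match the spherical case. -/
theorem sq_add_sq_le_of_cosh_le {a b c : ℝ} (hc0 : 0 ≤ c) (hc : c ≤ 1)
    (h : Real.cosh a * Real.cosh b ≤ Real.cosh c) : a ^ 2 + b ^ 2 ≤ c ^ 2 + 10 * c ^ 4 := by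
  have h1 := mul_le_mul (one_add_sq_half_le_cosh a) (one_add_sq_half_le_cosh b) (by positivity)
    (by positivity)
  have h2 := Real.cosh_le_exp_half_sq c
  have hc2 : c ^ 2 ≤ 1 := pow_le_one₀ hc0 hc
  have h3 := (abs_le.1 (Real.abs_exp_sub_one_sub_id_le (x := c ^ 2 / 2)
    (by rw [abs_of_nonneg (by positivity)]; linarith))).2
  have h4 : 0 ≤ c ^ 4 := by positivity
  have h5 : 0 ≤ a ^ 2 * b ^ 2 := by positivity
  nlinarith

/-! ### Transfer to CAT(κ) spaces and assertion (iii) -/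

/-- Comparison triangle for a triangle `u, y, x` in which `u` is a nearest point to `x` on the
side from `u` to `y`. -/
theorem TriangleComparison.exists_nearest {κ : ℝ} {M : Type} {δ : M → M → ℝ}
    (h : TriangleComparison G κ δ) (hself : ∀ v, δ v v = 0) (hsymm : ∀ v w, δ v w = δ w v)
    (hgeo : ∀ x y : G, ∃ γ : ℝ → G, IsGeodesic γ x y) {u y x : G}
    (hper : 0 < κ → √κ * (dist u y + dist y x + dist x u) < 2 * Real.pi)
    {γ : ℝ → G} (hγ : IsGeodesic γ u y)
    (hnear : ∀ t ∈ Icc (0 : ℝ) 1, dist x u ≤ dist x (γ t)) :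
    ∃ u' y' x' : M, δ u' y' = dist u y ∧ δ y' x' = dist y x ∧ δ x' u' = dist x u ∧
      ∀ s ∈ Icc (0 : ℝ) 1, ∀ a : M, δ u' a = s * δ u' y' → δ a y' = (1 - s) * δ u' y' →
        δ x' u' ≤ δ a x' := by
  obtain ⟨u', y', x', h1, h2, h3, hcomp⟩ := h u y x hper
  obtain ⟨η, hη⟩ := hgeo u x
  refine ⟨u', y', x', h1, h2, h3, fun s hs a ha1 ha2 => ?_⟩
  rw [h1] at ha1 ha2
  -- Parameter `1` on the side from `u` to `x` is the vertex `x`. Comparison bounds `d(γ s, x)`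
  -- above by its model distance, which is the direction that preserves nearness.
  have := hcomp γ η hγ hη s hs 1 ⟨zero_le_one, le_rfl⟩ a x' ha1 ha2
    (by rw [hsymm, h3, one_mul, dist_comm]) (by rw [hself, sub_self, zero_mul])
  rw [hη.2.1, dist_comm] at this
  rw [h3]
  exact (hnear s hs).trans this

theorem IsCAT.sq_add_sq_le {κ : ℝ} (h : IsCAT G κ)
    (hgeo : ∀ x y : G, ∃ γ : ℝ → G, IsGeodesic γ x y) {u y x : G} {γ : ℝ → G}
    (hγ : IsGeodesic γ u y) (hnear : ∀ t ∈ Icc (0 : ℝ) 1, dist x u ≤ dist x (γ t))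
    (hsmall : 3 * (√|κ| * dist x y) ≤ 1) :
    dist u y ^ 2 + dist x u ^ 2 ≤ (1 + 10 * |κ| * dist x y ^ 2) * dist x y ^ 2 := by
  have hxu : dist x u ≤ dist x y := by
    have := hnear 1 ⟨zero_le_one, le_rfl⟩
    rwa [hγ.2.1] at this
  have huy : dist u y ≤ 2 * dist x y := by
    have := dist_triangle_left u y x
    linarith
  -- The spherical and hyperbolic first variations need a nondegenerate side, so `u = y` is treated
  -- apart.
  rcases (dist_nonneg (x := u) (y := y)).eq_or_lt with h0 | h0
  · rw [← h0]
    have h1 := pow_le_pow_left₀ dist_nonneg hxu 2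
    have h2 : 0 ≤ 10 * |κ| * dist x y ^ 2 * dist x y ^ 2 := by positivity
    linarith
  rcases lt_trichotomy κ 0 with hκ | hκ | hκ
  · have hk : 0 < √(-κ) := Real.sqrt_pos.2 (by linarith)
    have hk2 : √(-κ) ^ 2 = -κ := Real.sq_sqrt (by linarith)
    obtain ⟨u', y', x', h1, h2, h3, hn⟩ := (h.2.2.2 hκ).exists_nearest
      (fun v => by simp [hyperbolicDist])
      (fun v w => by rw [hyperbolicDist, hyperbolicDist, dist_comm])
      hgeo (fun hk' => absurd hk' (by linarith)) hγ hnear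
    simp only [hyperbolicDist, ← mul_div_assoc, div_left_inj' hk.ne',
      div_le_div_iff_of_pos_right hk] at hn
    rw [hyperbolicDist, div_eq_iff hk.ne'] at h1 h2 h3
    have h4 := cosh_dist_ge_of_nearest (by rw [h1]; positivity) hn
    rw [abs_of_neg hκ] at hsmall ⊢
    rw [dist_comm y x] at h2
    have h5 := sq_add_sq_le_of_cosh_le (by positivity) (by rw [h2]; linarith) h4
    rw [h1, h2, h3] at h5
    refine le_of_mul_le_mul_left ?_ (neg_pos.2 hκ)
    rw [← hk2]
    linarith
  · subst hκ
    obtain ⟨u', y', x', h1, h2, h3, hn⟩ := (h.2.2.1 rfl).exists_nearest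
      (fun v => dist_self v) (fun v w => dist_comm v w)
      hgeo (fun hk' => absurd hk' (lt_irrefl _)) hγ hnear
    have h4 := sq_add_sq_le_of_nearest hn
    rw [h1, h2, h3, dist_comm y x] at h4
    simpa using h4
  · have hk : 0 < √κ := Real.sqrt_pos.2 hκ
    have hk2 : √κ ^ 2 = κ := Real.sq_sqrt hκ.le
    rw [abs_of_pos hκ] at hsmall ⊢
    have e1 := mul_le_mul_of_nonneg_left hxu hk.le
    have e2 := mul_le_mul_of_nonneg_left huy hk.le
    have hpi := Real.pi_gt_three
    obtain ⟨u', y', x', h1, h2, h3, hn⟩ := (h.2.1 hκ).exists_nearest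
      (fun v => by
        rw [sphereDist, InnerProductGeometry.angle_self (Metric.ne_of_mem_sphere v.2 one_ne_zero),
          zero_div])
      (fun v w => by rw [sphereDist, sphereDist, InnerProductGeometry.angle_comm])
      hgeo (fun _ => by rw [dist_comm y x]; linarith) hγ hnear
    simp only [sphereDist, ← mul_div_assoc, div_left_inj' hk.ne',
      div_le_div_iff_of_pos_right hk] at hn
    rw [sphereDist, div_eq_iff hk.ne'] at h1 h2 h3
    rw [dist_comm y x] at h2
    have h4 := cos_angle_le_of_nearest (norm_eq_of_mem_sphere u') (norm_eq_of_mem_sphere y')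
      (norm_eq_of_mem_sphere x') (by rw [h1]; positivity) (by rw [h1]; linarith)
      (fun s hs a ha => hn s hs ⟨a, mem_sphere_zero_iff_norm.2 ha⟩)
    rw [h1, h2, h3] at h4
    have h5 := sq_add_sq_le_of_cos_le (by positivity) (by positivity) (by linarith)
      (by linarith) (by linarith) h4
    refine le_of_mul_le_mul_left ?_ hκ
    rw [← hk2]
    linarith

/-- Superadditivity of `s ^ (p / 2)` on nonnegative reals, which needs `p ≥ 2`. -/
theorem rpow_add_rpow_le_of_sq_add_sq_le (hp : 2 ≤ p) {a b d K : ℝ} (ha : 0 ≤ a) (hb : 0 ≤ b)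
    (hd : 0 ≤ d) (hK : 0 ≤ K) (h : a ^ 2 + b ^ 2 ≤ K * d ^ 2) :
    a ^ p + b ^ p ≤ K ^ (p / 2) * d ^ p := by
  have h1 := Real.add_rpow_le_rpow_add (sq_nonneg a) (sq_nonneg b) (by linarith : 1 ≤ p / 2)
  rw [sq_rpow_half p ha, sq_rpow_half p hb] at h1
  have h2 := Real.rpow_le_rpow (by positivity) h (by linarith : 0 ≤ p / 2)
  rw [Real.mul_rpow hK (by positivity), sq_rpow_half p hd] at h2
  exact h1.trans h2

theorem IsProx.asymptoticallyFirmlyNonexpansiveAt {f : G → EReal} {lam : ℝ} {T : G → G}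
    (hT : IsProx p lam f T) (hp : 1 < p) (hc : 0 < c) (hlam : 0 < lam)
    (hG : PUniformlyConvex G p c) (hf : ProperFun f) (hconv : GeodesicallyConvex f) {κ : ℝ}
    (hκ : IsCAT G κ) {y : G} (hy : y ∈ argmin f) {c' : ℝ} (hc' : c' ≤ 2) :
    AsymptoticallyFirmlyNonexpansiveAt p c' (1 / 2) T y := by
  have hp0 : 0 < p := by linarith
  have hTy := hT.eq_of_mem_argmin hp hlam hy
  refine ⟨by norm_num, fun ε hε => ?_⟩
  -- For `α = 1/2` the factor `(1 - α)/α` is `1`, and `c' ≤ 2` bounds the discrepancy at the fixed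
  -- point `y` by `d(x, Tx)^p`; so `c'` drops out.
  suffices hU : ∃ U ∈ 𝓝 y, ∀ x ∈ U, dist (T x) y ^ p + dist x (T x) ^ p ≤
      (1 + ε) * dist x y ^ p by
    obtain ⟨U, hU, hle⟩ := hU
    refine ⟨U, hU, fun x hx => ?_⟩
    have h1 := hle x hx
    rw [transportDiscrepancy_of_fixed hp0 c' hTy, hTy, dist_comm (T x) x]
    have h2 : c' / 2 * dist x (T x) ^ p ≤ 1 * dist x (T x) ^ p := by
      gcongr
      linarith
    norm_num
    linarith
  rcases lt_or_ge p 2 with hp2 | hp2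
  · have := hG.subsingleton_of_lt_two hp hp2 hc
    refine ⟨univ, univ_mem, fun x _ => ?_⟩
    rw [Subsingleton.elim (T x) y, Subsingleton.elim x y, dist_self, Real.zero_rpow hp0.ne']
    simp
  · have hcont : Tendsto (fun x => (1 + 10 * |κ| * dist x y ^ 2) ^ (p / 2)) (𝓝 y)
        (𝓝 ((1 + 10 * |κ| * dist y y ^ 2) ^ (p / 2))) := by
      refine Tendsto.rpow_const (Continuous.tendsto ?_ y) (Or.inr (by linarith))
      fun_prop
    have hcont' : Tendsto (fun x => 3 * (√|κ| * dist x y)) (𝓝 y)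
        (𝓝 (3 * (√|κ| * dist y y))) := by
      refine Continuous.tendsto ?_ y
      fun_prop
    rw [dist_self] at hcont hcont'
    norm_num at hcont hcont'
    refine ⟨_, (hcont.eventually_le_const (by linarith : 1 < 1 + ε)).and
      (hcont'.eventually_le_const zero_lt_one), fun x hx => ?_⟩
    obtain ⟨γ, hγ⟩ := hG.1 (T x) y
    have h1 := hκ.sq_add_sq_le hG.1 hγ
      (fun t ht => hT.dist_le_of_isGeodesic hp hlam hf hconv hy hγ ht) hx.2
    have h2 := rpow_add_rpow_le_of_sq_add_sq_le hp2 dist_nonneg dist_nonneg dist_nonneg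
      (by positivity) h1
    exact h2.trans (mul_le_mul_of_nonneg_right hx.1 (by positivity))

end PProx

theorem theorem4p1 {G : Type*} [MetricSpace G] [CompleteSpace G]
    (p c lam : ℝ) (hp : 1 < p) (hc : 0 < c) (hc2 : c ≤ 2) (hlam : 0 < lam)
    (hG : PProx.PUniformlyConvex G p c)
    (f : G → EReal) (hf : PProx.ProperFun f) (hconv : PProx.GeodesicallyConvex f)
    (hlsc : LowerSemicontinuous f) :
    ∃ T : G → G, PProx.IsProx p lam f T ∧
      (PProx.SymmetricPerpendicular G →
        PProx.argmin f = Function.fixedPoints T ∧ PProx.QuasiStrictlyNonexpansive T) ∧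
      (1 < c → ∀ y ∈ PProx.argmin f,
        PProx.AlmostFirmlyNonexpansiveAt p c (c * (c - 1) / (c * (c - 1) + 2))
          ((2 - c) / (c - 1)) T Set.univ y) ∧
      (∀ κ : ℝ, PProx.IsCAT G κ → ∀ y ∈ PProx.argmin f, ∀ c' : ℝ, 0 < c' → c' ≤ 2 →
        PProx.AsymptoticallyFirmlyNonexpansiveAt p c' (1 / 2) T y) := by
  obtain ⟨T, hT⟩ := PProx.exists_isProx hp hc hlam hG hf hconv hlsc
  exact ⟨T, hT,
    fun hsymm => ⟨hT.argmin_eq_fixedPoints hp hlam hG.1 hf hconv,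
      hT.quasiStrictlyNonexpansive hp hc hlam hG hf hconv hsymm⟩,
    fun hc1 y hy => hT.almostFirmlyNonexpansiveAt hp hc2 hlam hG hf hconv hc1 hy,
    fun κ hκ y hy c' _ hc' =>
      hT.asymptoticallyFirmlyNonexpansiveAt hp hc hlam hG hf hconv hκ hy hc'⟩
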